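/- All Hilbert spaces are finite-dimensional, and $S(\rho)=-\mathrm{Tr}\,\rho\log\rho$ is the von Neumann entropy. For a bipartite state $\rho_{AX}$ let $$E(\rho_{AX})=\min\sum_i p_i\,S\big(\mathrm{Tr}_X|\psi_i\rangle\langle\psi_i|\big)$$ be the entanglement of formation, where the minimum is over all finite decompositions $\rho_{AX}=\sum_i p_i|\psi_i\rangle\langle\psi_i|$ into pure states, and let $$D(\rho_{AX})=D^{(X)}(\rho_{AX})=S(\rho_A)+S(\rho_X)-S(\rho_{AX})-J^{(X)}(\rho_{AX}),\qquad J^{(X)}(\rho_{AX})=\max_{\{\Pi_i\}}\Big[S(\rho_A)-\sum_i p_i\,S(\rho_{A|i})\Big]$$ be the quantum discord with measurement on $X$, where the maximum is over all measurements on $X$, i.e. finite families of positive semidefinite operators $\Pi_i$ on $\mathcal H_X$ with $\sum_i\Pi_i=\mathbb I$ (POVMs), $p_i=\mathrm{Tr}[(\mathbb I\otimes\Pi_i)\rho_{AX}]$ is the probability of the outcome $i$ and $\rho_{A|i}=\mathrm{Tr}_X[(\mathbb I\otimes\Pi_i)\rho_{AX}]/p_i$ is the resulting state of $A$. **Theorem.**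 Let $\rho_{ABC}$ be a tripartite state with marginals $\rho_{AB},\rho_{AC},\rho_B,\rho_C$, and let $$T^{(a)}(\rho_{ABC})=S(\rho_{AB})+S(\rho_{AC})-S(\rho_B)-S(\rho_C).$$ Let $|\psi_{ABCE}\rangle$ be any purification of $\rho_{ABC}$ with a finite-dimensional auxiliary system $E$; write $\widetilde B=BE$, $\widetilde C=CE$, $\rho_{A\widetilde B}=\mathrm{Tr}_C|\psi\rangle\langle\psi|$ and $\rho_{A\widetilde C}=\mathrm{Tr}_B|\psi\rangle\langle\psi|$. Then $$\begin{aligned}T^{(a)}(\rho_{ABC})&=\big[E(\rho_{A\widetilde B})-E(\rho_{AB})\big]+\big[D^{(\widetilde C)}(\rho_{A\widetilde C})-D^{(C)}(\rho_{AC})\big]\\&=\big[E(\rho_{A\widetilde C})-E(\rho_{AC})\big]+\big[D^{(\widetilde B)}(\rho_{A\widetilde B})-D^{(B)}(\rho_{AB})\big]\\&=\big[E(\rho_{A\widetilde B})+E(\rho_{A\widetilde C})\big]-\big[D^{(B)}(\rho_{AB})+D^{(C)}(\rho_{AC})\big]\\&=\big[D^{(\widetilde B)}(\rho_{A\widetilde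 B})+D^{(\widetilde C)}(\rho_{A\widetilde C})\big]-\big[E(\rho_{AB})+E(\rho_{AC})\big].\end{aligned}$$ Moreover $E(\rho_{A\widetilde X})-E(\rho_{AX})\ge 0$ for $X=B,C$. -/

import Mathlib

namespace QInfo

open scoped ComplexOrder

/-! Finite-dimensional quantum systems in coordinates: a system with Hilbert space `ℂ^A` is given by
a finite index type `A`; composite systems have product index types; operators are matrices and
vectors are functions. -/

/-- Density matrices: positive semidefinite with unit trace. -/
def IsState {A : Type*} [Fintype A] (ρ : Matrix A A ℂ) : Prop :=
  ρ.PosSemidef ∧ ρ.trace = 1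

/-- The rank-one operator `|ψ⟩⟨ψ|`. -/
def ketbra {A : Type*} (ψ : A → ℂ) : Matrix A A ℂ :=
  Matrix.vecMulVec ψ (star ψ)

/-- The von Neumann entropy `S(ρ) = -Tr (ρ log ρ)`, through the functional calculus of the Hermitian
matrix `ρ` for the function `x ↦ -x log x` (with value `0` at `0`); natural logarithm. -/
noncomputable def entropy {A : Type*} [Fintype A] [DecidableEq A] (ρ : Matrix A A ℂ) : ℝ :=
  (cfc Real.negMulLog ρ).trace.re

/-- Partial trace over the second factor of a bipartite system. -/
def traceSnd {A B : Type*} [Fintype B] (ρ : Matrix (A × B) (A × B) ℂ) : Matrix A A ℂ :=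
  Matrix.of fun a a' => ∑ b, ρ (a, b) (a', b)

/-- Partial trace over the first factor of a bipartite system. -/
def traceFst {A B : Type*} [Fintype A] (ρ : Matrix (A × B) (A × B) ℂ) : Matrix B B ℂ :=
  Matrix.of fun b b' => ∑ a, ρ (a, b) (a, b')

/-- `ρ_AB = Tr_C ρ_ABC`. -/
def margAB {A B C : Type*} [Fintype C] (ρ : Matrix (A × B × C) (A × B × C) ℂ) :
    Matrix (A × B) (A × B) ℂ :=
  Matrix.of fun x y => ∑ c, ρ (x.1, x.2, c) (y.1, y.2, c)

/-- `ρ_AC = Tr_B ρ_ABC`. -/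
def margAC {A B C : Type*} [Fintype B] (ρ : Matrix (A × B × C) (A × B × C) ℂ) :
    Matrix (A × C) (A × C) ℂ :=
  Matrix.of fun x y => ∑ b, ρ (x.1, b, x.2) (y.1, b, y.2)

/-- The gap `S(AB) + S(AC) - S(B) - S(C)` in the strong subadditivity inequality. -/
noncomputable def ssaGap {A B C : Type*} [Fintype A] [Fintype B] [Fintype C]
    [DecidableEq A] [DecidableEq B] [DecidableEq C]
    (ρ : Matrix (A × B × C) (A × B × C) ℂ) : ℝ :=
  entropy (margAB ρ) + entropy (margAC ρ) - entropy (traceFst (margAB ρ))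
    - entropy (traceFst (margAC ρ))

/-- `ψ` is a vector of `ABCE` with `Tr_E |ψ⟩⟨ψ| = ρ_ABC`. -/
def IsPurification {A B C E : Type*} [Fintype E]
    (ψ : A × B × C × E → ℂ) (ρ : Matrix (A × B × C) (A × B × C) ℂ) : Prop :=
  ∀ a b c a' b' c', ρ (a, b, c) (a', b', c') =
    ∑ e, ketbra ψ (a, b, c, e) (a', b', c', e)

/-- `ρ_{A,BE} = Tr_C |ψ⟩⟨ψ|`, as a bipartite operator on `A` and `BE`. -/
def margABE {A B C E : Type*} [Fintype C] (ψ : A × B × C × E → ℂ) :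
    Matrix (A × (B × E)) (A × (B × E)) ℂ :=
  Matrix.of fun x y => ∑ c, ketbra ψ (x.1, x.2.1, c, x.2.2) (y.1, y.2.1, c, y.2.2)

/-- `ρ_{A,CE} = Tr_B |ψ⟩⟨ψ|`, as a bipartite operator on `A` and `CE`. -/
def margACE {A B C E : Type*} [Fintype B] (ψ : A × B × C × E → ℂ) :
    Matrix (A × (C × E)) (A × (C × E)) ℂ :=
  Matrix.of fun x y => ∑ b, ketbra ψ (x.1, b, x.2.1, x.2.2) (y.1, b, y.2.1, y.2.2)

/-- `ρ = ∑ i, p i |ψ i⟩⟨ψ i|` with probabilities `p i` and unit vectors `ψ i`. -/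
structure IsPureDecomposition {A : Type*} [Fintype A] (ρ : Matrix A A ℂ) {n : ℕ}
    (p : Fin n → ℝ) (ψ : Fin n → A → ℂ) : Prop where
  prob_nonneg : ∀ i, 0 ≤ p i
  prob_sum : ∑ i, p i = 1
  unit : ∀ i, ∑ a, ‖ψ i a‖ ^ 2 = 1
  sum_eq : ρ = ∑ i, (p i : ℂ) • ketbra (ψ i)

/-- Entanglement of formation: the least average entanglement `∑ i, p i S(Tr_B |ψ i⟩⟨ψ i|)` over
all finite decompositions of `ρ_AB` into pure states. -/
noncomputable def eof {A B : Type*} [Fintype A] [Fintype B] [DecidableEq A]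
    (ρ : Matrix (A × B) (A × B) ℂ) : ℝ :=
  sInf {r : ℝ | ∃ (n : ℕ) (p : Fin n → ℝ) (ψ : Fin n → A × B → ℂ),
    IsPureDecomposition ρ p ψ ∧ r = ∑ i, p i * entropy (traceSnd (ketbra (ψ i)))}

/-- Mutual information `S(A) + S(B) - S(AB)`. -/
noncomputable def mutualInfo {A B : Type*} [Fintype A] [Fintype B] [DecidableEq A] [DecidableEq B]
    (ρ : Matrix (A × B) (A × B) ℂ) : ℝ :=
  entropy (traceSnd ρ) + entropy (traceFst ρ) - entropy ρ

/-- A measurement (POVM) with finitely many outcomes; complete families of orthogonal projections are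
a special case. -/
structure IsMeasurement {B : Type*} [Fintype B] [DecidableEq B] {n : ℕ}
    (M : Fin n → Matrix B B ℂ) : Prop where
  posSemidef : ∀ i, (M i).PosSemidef
  sum_eq_one : ∑ i, M i = 1

/-- The unnormalized state `Tr_B ((1 ⊗ M) ρ)` of `A` after the outcome with effect `M` on `B`. -/
noncomputable def outcomeState {A B : Type*} [Fintype A] [Fintype B] [DecidableEq A]
    (ρ : Matrix (A × B) (A × B) ℂ) (M : Matrix B B ℂ) : Matrix A A ℂ :=
  traceSnd (Matrix.kronecker (1 : Matrix A A ℂ) M * ρ)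

/-- The probability `Tr ((1 ⊗ M) ρ)` of the outcome with effect `M` on `B`. -/
noncomputable def outcomeProb {A B : Type*} [Fintype A] [Fintype B] [DecidableEq A]
    (ρ : Matrix (A × B) (A × B) ℂ) (M : Matrix B B ℂ) : ℝ :=
  (Matrix.kronecker (1 : Matrix A A ℂ) M * ρ).trace.re

/-- The information `S(A) - ∑ i, p i S(A | outcome i)` gained about `A` by the measurement `M` of
`B`; outcomes of probability zero contribute nothing. -/
noncomputable def measuredInfo {A B : Type*} [Fintype A] [Fintype B] [DecidableEq A]
    (ρ : Matrix (A × B) (A × B) ℂ) {n : ℕ} (M : Fin n → Matrix B B ℂ) : ℝ :=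
  entropy (traceSnd ρ) - ∑ i, outcomeProb ρ (M i) *
    entropy (((outcomeProb ρ (M i))⁻¹ : ℂ) • outcomeState ρ (M i))

/-- Classical correlation: the largest information gained about `A` by a measurement of `B`. -/
noncomputable def classicalCorr {A B : Type*} [Fintype A] [Fintype B] [DecidableEq A]
    [DecidableEq B] (ρ : Matrix (A × B) (A × B) ℂ) : ℝ :=
  sSup {r : ℝ | ∃ (n : ℕ) (M : Fin n → Matrix B B ℂ), IsMeasurement M ∧ r = measuredInfo ρ M}

/-- Quantum discord with measurement on the second subsystem. -/
noncomputable def discord {A B : Type*} [Fintype A] [Fintype B] [DecidableEq A] [DecidableEq B]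
    (ρ : Matrix (A × B) (A × B) ℂ) : ℝ :=
  mutualInfo ρ - classicalCorr ρ

end QInfo

namespace QInfo

open scoped ComplexOrder Matrix MatrixOrder

/-! Everything rests on the Koashi–Winter relation (`isLUB_measuredInfo`). For a pure state of `AXY`
with amplitude matrix `Φ` across `AX|Y`, rank-one measurements on `Y` steer `AX` into pure-state
decompositions of `Φ * Φᴴ`. Conversely, every decomposition arises this way, since its vectors
factor through `Φ` by a contraction (`exists_contraction_factor`). General measurements refine to
rank-one ones, and concavity of the entropy (`sum_weightedEntropy_le`) shows that this loses no
information. Hence J(AY) = S(A) - E(AX), that is, E(AX) - D(AY) = S(AY) - S(Y) (`eof_sub_discord`).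

Apply this to `|ψ⟩` with (X, Y) = (BE, C), (CE, B), (B, CE), (C, BE). Complementary marginals of a
pure state have equal entropies, so the right-hand sides are S(AC) - S(C), S(AB) - S(B) and their
negatives S(B) - S(AB), S(C) - S(AC). The four formulas are linear combinations of these relations.

For the inequalities, a measurement on `C` is also one on `CE`, so J(AC) ≤ J(A,CE). Koashi–Winter
turns this into E(AB) ≤ E(A,BE), and likewise with B and C exchanged (`eof_le_of_traceAux`). -/

lemma trace_re_nonneg {A : Type*} [Fintype A] {σ : Matrix A A ℂ} (h : σ.PosSemidef) :
    0 ≤ σ.trace.re :=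
  (Complex.nonneg_iff.mp h.trace_nonneg).1

lemma trace_eq_re {A : Type*} [Fintype A] {σ : Matrix A A ℂ} (h : σ.PosSemidef) :
    σ.trace = (σ.trace.re : ℂ) := by
  refine Complex.ext rfl ?_
  rw [Complex.ofReal_im]
  exact (Complex.nonneg_iff.mp h.trace_nonneg).2.symm

lemma posSemidef_normalize {A : Type*} [Fintype A] {σ : Matrix A A ℂ}
    (h : σ.PosSemidef) :
    (((σ.trace.re : ℂ))⁻¹ • σ).PosSemidef := by
  refine h.smul ?_
  rw [← Complex.ofReal_inv]
  exact_mod_cast inv_nonneg.mpr (trace_re_nonneg h)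

lemma trace_re_smul_normalize {A : Type*} [Fintype A] {σ : Matrix A A ℂ}
    (h : σ.PosSemidef) :
    (σ.trace.re : ℂ) • (((σ.trace.re : ℂ))⁻¹ • σ) = σ := by
  by_cases h0 : σ.trace.re = 0
  · have : σ = 0 := by
      rw [← h.trace_eq_zero_iff, trace_eq_re h, h0, Complex.ofReal_zero]
    simp [this]
  · rw [smul_smul, mul_inv_cancel₀ (by exact_mod_cast h0), one_smul]

/-! ### Spectral form and concavity of the von Neumann entropy. -/

section Entropy

variable {A : Type*} [Fintype A] [DecidableEq A]

/-- The functional calculus of a Hermitian matrix is diagonal in an eigenbasis. -/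
lemma cfc_eq_conj {ρ : Matrix A A ℂ} (h : ρ.IsHermitian) (f : ℝ → ℝ) :
    cfc f ρ = (h.eigenvectorUnitary : Matrix A A ℂ) *
      Matrix.diagonal (fun i => (f (h.eigenvalues i) : ℂ)) *
        (h.eigenvectorUnitary : Matrix A A ℂ)ᴴ := by
  rw [h.cfc_eq]
  rfl

lemma eigenvectorUnitary_conjTranspose_mul_self {ρ : Matrix A A ℂ} (h : ρ.IsHermitian) :
    (h.eigenvectorUnitary : Matrix A A ℂ)ᴴ * (h.eigenvectorUnitary : Matrix A A ℂ) = 1 :=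
  Unitary.coe_star_mul_self _

lemma isHermitian_eq_conj {ρ : Matrix A A ℂ} (h : ρ.IsHermitian) :
    ρ = (h.eigenvectorUnitary : Matrix A A ℂ) *
      Matrix.diagonal (fun i => (h.eigenvalues i : ℂ)) *
        (h.eigenvectorUnitary : Matrix A A ℂ)ᴴ := by
  conv_lhs => rw [h.spectral_theorem]
  rfl

lemma entropy_eq_sum {ρ : Matrix A A ℂ} (h : ρ.IsHermitian) :
    entropy ρ = ∑ i, Real.negMulLog (h.eigenvalues i) := by
  rw [entropy, cfc_eq_conj h, Matrix.trace_mul_comm, ← mul_assoc,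
    eigenvectorUnitary_conjTranspose_mul_self, one_mul, Matrix.trace_diagonal]
  simp

lemma sum_eigenvalues {ρ : Matrix A A ℂ} (h : ρ.IsHermitian) :
    ∑ i, h.eigenvalues i = ρ.trace.re := by
  conv_rhs => rw [isHermitian_eq_conj h, Matrix.trace_mul_comm, ← mul_assoc,
    eigenvectorUnitary_conjTranspose_mul_self, one_mul, Matrix.trace_diagonal]
  simp

lemma entropy_nonneg {ρ : Matrix A A ℂ} (h : ρ.PosSemidef) (h1 : ρ.trace.re ≤ 1) :
    0 ≤ entropy ρ := by
  rw [entropy_eq_sum h.isHermitian]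
  refine Finset.sum_nonneg fun i _ => Real.negMulLog_nonneg (h.eigenvalues_nonneg i) ?_
  refine le_trans ?_ (sum_eigenvalues h.isHermitian |>.trans_le h1)
  exact Finset.single_le_sum (fun j _ => h.eigenvalues_nonneg j) (Finset.mem_univ i)

/-- The entropy only depends on the characteristic polynomial. -/
lemma entropy_eq_roots {ρ : Matrix A A ℂ} (h : ρ.IsHermitian) :
    entropy ρ = (ρ.charpoly.roots.map fun z => Real.negMulLog z.re).sum := by
  rw [entropy_eq_sum h, h.roots_charpoly_eq_eigenvalues, Multiset.map_map]
  simp [Function.comp_def]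

lemma entropy_transpose {ρ : Matrix A A ℂ} (h : ρ.IsHermitian) : entropy ρᵀ = entropy ρ := by
  rw [entropy_eq_roots h, entropy_eq_roots h.transpose, Matrix.charpoly_transpose]

/-- `M Mᴴ` and `Mᴴ M` have the same entropy. -/
lemma entropy_mul_conjTranspose {B : Type*} [Fintype B] [DecidableEq B] (M : Matrix A B ℂ) :
    entropy (M * Mᴴ) = entropy (Mᴴ * M) := by
  rw [entropy_eq_roots (Matrix.isHermitian_mul_conjTranspose_self M),
    entropy_eq_roots (Matrix.isHermitian_conjTranspose_mul_self M)]
  -- The two characteristic polynomials agree up to powers of `X`; the surplus roots are zero and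
  -- contribute nothing, as `negMulLog 0 = 0`.
  have key := congrArg Polynomial.roots (Matrix.charpoly_mul_comm' M Mᴴ)
  rw [Polynomial.roots_mul
      (mul_ne_zero (pow_ne_zero _ Polynomial.X_ne_zero) (Matrix.charpoly_monic _).ne_zero),
    Polynomial.roots_mul
      (mul_ne_zero (pow_ne_zero _ Polynomial.X_ne_zero) (Matrix.charpoly_monic _).ne_zero)] at key
  have := congrArg (fun s => (s.map fun z : ℂ => Real.negMulLog z.re).sum) key
  simpa [Multiset.map_nsmul, Multiset.sum_nsmul] using this

lemma conj_cfc_apply {ρ : Matrix A A ℂ} (h : ρ.IsHermitian) (f : ℝ → ℝ) (V : Matrix A A ℂ)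
    (k : A) :
    ((Vᴴ * cfc f ρ * V) k k).re = ∑ i, ‖((h.eigenvectorUnitary : Matrix A A ℂ)ᴴ * V) i k‖ ^ 2 *
      f (h.eigenvalues i) := by
  have : Vᴴ * cfc f ρ * V = ((h.eigenvectorUnitary : Matrix A A ℂ)ᴴ * V)ᴴ *
      Matrix.diagonal (fun i => (f (h.eigenvalues i) : ℂ)) *
        ((h.eigenvectorUnitary : Matrix A A ℂ)ᴴ * V) := by
    rw [cfc_eq_conj h, Matrix.conjTranspose_mul, Matrix.conjTranspose_conjTranspose]
    simp only [mul_assoc]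
  rw [this, Matrix.mul_apply, Complex.re_sum]
  refine Finset.sum_congr rfl fun i _ => ?_
  generalize (h.eigenvectorUnitary : Matrix A A ℂ)ᴴ * V = W
  rw [Matrix.mul_diagonal, Matrix.conjTranspose_apply, mul_right_comm, ← Complex.ofReal_re
    (‖W i k‖ ^ 2 * f (h.eigenvalues i))]
  congr 1
  push_cast
  rw [← Complex.conj_mul']
  rfl

/-- Each diagonal entry in the basis `V` is an average of eigenvalues with weights the squared
overlaps of the two bases, so Jensen's inequality for `negMulLog` applies entrywise. -/
lemma entropy_le_sum_diag {ρ : Matrix A A ℂ} (h : ρ.PosSemidef) {V : Matrix A A ℂ}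
    (hV : Vᴴ * V = 1) :
    entropy ρ ≤ ∑ k, Real.negMulLog ((Vᴴ * ρ * V) k k).re := by
  have hV' : V * Vᴴ = 1 := mul_eq_one_comm.mp hV
  have hH := h.isHermitian
  have h1 : entropy ρ = ∑ k, ((Vᴴ * cfc Real.negMulLog ρ * V) k k).re := by
    rw [← Complex.re_sum, entropy]
    change _ = (Vᴴ * cfc Real.negMulLog ρ * V).trace.re
    rw [mul_assoc, Matrix.trace_mul_comm, mul_assoc, hV', mul_one]
  rw [h1]
  refine Finset.sum_le_sum fun k _ => ?_
  have hid : ρ = cfc (fun x : ℝ => x) ρ := (cfc_id' ℝ ρ).symm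
  conv_rhs => rw [hid, conj_cfc_apply hH]
  rw [conj_cfc_apply hH]
  refine Real.concaveOn_negMulLog.le_map_sum (fun i _ => sq_nonneg _) ?_
    (fun i _ => h.eigenvalues_nonneg i)
  -- The constant function 1 in `conj_cfc_apply` says that the weights sum to 1.
  have h2 := conj_cfc_apply hH (fun _ => 1) V k
  rw [cfc_const_one ℝ ρ, mul_one, hV] at h2
  simpa using h2.symm

/-- Concavity of the von Neumann entropy. -/
lemma sum_mul_entropy_le {ι : Type*} [Fintype ι] (q : ι → ℝ) (hq : ∀ i, 0 ≤ q i)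
    (hq1 : ∑ i, q i = 1) (σ : ι → Matrix A A ℂ) (hσ : ∀ i, (σ i).PosSemidef) :
    ∑ i, q i * entropy (σ i) ≤ entropy (∑ i, (q i : ℂ) • σ i) := by
  have hP : (∑ i, (q i : ℂ) • σ i).PosSemidef :=
    Matrix.posSemidef_sum _ fun i _ => (hσ i).smul (by exact_mod_cast hq i)
  set ρ := ∑ i, (q i : ℂ) • σ i with hρ
  have hH := hP.isHermitian
  set V : Matrix A A ℂ := (hH.eigenvectorUnitary : Matrix A A ℂ) with hVdef
  have hV : Vᴴ * V = 1 := eigenvectorUnitary_conjTranspose_mul_self hH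
  -- In the eigenbasis of the mixture, its spectrum is the average of the diagonals of the `σ i`;
  -- this reduces concavity to the scalar case.
  have hd : ∀ k, hH.eigenvalues k = ∑ i, q i * ((Vᴴ * σ i * V) k k).re := by
    intro k
    have h1 : Vᴴ * ρ * V = Matrix.diagonal (fun i => (hH.eigenvalues i : ℂ)) := by
      have := isHermitian_eq_conj hH
      rw [← hVdef] at this
      calc Vᴴ * ρ * V = (Vᴴ * V) * Matrix.diagonal (fun i => (hH.eigenvalues i : ℂ)) *
            (Vᴴ * V) := by
            conv_lhs => rw [this]
            simp only [mul_assoc]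
        _ = _ := by rw [hV, one_mul, mul_one]
    have h2 := congrArg (fun M => (M k k).re) h1
    simp only [Matrix.diagonal_apply_eq, Complex.ofReal_re] at h2
    rw [← h2, hρ, Finset.mul_sum, Finset.sum_mul, Matrix.sum_apply, Complex.re_sum]
    simp
  rw [entropy_eq_sum hH]
  calc ∑ i, q i * entropy (σ i)
      ≤ ∑ i, q i * ∑ k, Real.negMulLog ((Vᴴ * σ i * V) k k).re :=
        Finset.sum_le_sum fun i _ => mul_le_mul_of_nonneg_left
          (entropy_le_sum_diag (hσ i) hV) (hq i)
    _ = ∑ k, ∑ i, q i * Real.negMulLog ((Vᴴ * σ i * V) k k).re := by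
        simp_rw [Finset.mul_sum]
        exact Finset.sum_comm
    _ ≤ _ := by
        refine Finset.sum_le_sum fun k _ => ?_
        rw [hd]
        refine Real.concaveOn_negMulLog.le_map_sum (fun i _ => hq i) hq1 fun i _ => ?_
        exact (Complex.nonneg_iff.mp ((hσ i).conjTranspose_mul_mul_same V).diag_nonneg).1

/-- The entropy of the normalization of an unnormalized state, weighted by its trace. -/
noncomputable def weightedEntropy (σ : Matrix A A ℂ) : ℝ :=
  σ.trace.re * entropy (((σ.trace.re : ℂ))⁻¹ • σ)

/-- The trace-weighted entropy is superadditive. -/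
lemma sum_weightedEntropy_le {ι : Type*} [Fintype ι] (σ : ι → Matrix A A ℂ)
    (hσ : ∀ i, (σ i).PosSemidef) :
    ∑ i, weightedEntropy (σ i) ≤ weightedEntropy (∑ i, σ i) := by
  have htr : (∑ i, σ i).trace.re = ∑ i, (σ i).trace.re := by
    rw [Matrix.trace_sum, Complex.re_sum]
  set t := (∑ i, σ i).trace.re with ht
  have ht0 : 0 ≤ t := htr ▸ Finset.sum_nonneg fun i _ => trace_re_nonneg (hσ i)
  rcases ht0.eq_or_lt with h0 | hpos
  · have : ∀ i, (σ i).trace.re = 0 := fun i =>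
      (Finset.sum_eq_zero_iff_of_nonneg fun i _ => trace_re_nonneg (hσ i)).mp
        (htr.symm.trans h0.symm) i (Finset.mem_univ i)
    simp [weightedEntropy, this]
  · have hc := sum_mul_entropy_le (fun i => t⁻¹ * (σ i).trace.re)
      (fun i => mul_nonneg (inv_nonneg.mpr ht0) (trace_re_nonneg (hσ i)))
      (by rw [← Finset.mul_sum, ← htr, inv_mul_cancel₀ hpos.ne'])
      (fun i => ((σ i).trace.re : ℂ)⁻¹ • σ i) fun i => posSemidef_normalize (hσ i)
    have hs : ∑ i, ((t⁻¹ * (σ i).trace.re : ℝ) : ℂ) • (((σ i).trace.re : ℂ)⁻¹ • σ i) =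
        (t : ℂ)⁻¹ • ∑ i, σ i := by
      rw [Finset.smul_sum]
      refine Finset.sum_congr rfl fun i _ => ?_
      rw [Complex.ofReal_mul, mul_smul, trace_re_smul_normalize (hσ i), Complex.ofReal_inv]
    rw [hs] at hc
    rw [weightedEntropy, ← ht]
    refine le_trans (le_of_eq ?_) (mul_le_mul_of_nonneg_left hc ht0)
    rw [Finset.mul_sum]
    refine Finset.sum_congr rfl fun i _ => ?_
    rw [weightedEntropy, ← mul_assoc, ← mul_assoc, mul_inv_cancel₀ hpos.ne', one_mul]

end Entropy

/-- If `K Kᴴ = Φ Φᴴ`, then `K` factors through `Φ` by a contraction. -/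
lemma exists_contraction_factor {m n k : Type*} [Fintype m] [Fintype n] [Fintype k]
    [DecidableEq m] [DecidableEq n] (Φ : Matrix m n ℂ) (K : Matrix m k ℂ)
    (h : K * Kᴴ = Φ * Φᴴ) :
    ∃ W : Matrix n k ℂ, K = Φ * W ∧ (1 - W * Wᴴ).PosSemidef := by
  set R := Φ * Φᴴ with hR
  have hRH : IsSelfAdjoint R := Matrix.isHermitian_mul_conjTranspose_self Φ
  have hfin : (spectrum ℝ R).Finite := Matrix.finite_real_spectrum
  have hc : ∀ f : ℝ → ℝ, ContinuousOn f (spectrum ℝ R) := fun f => hfin.continuousOn f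
  -- As `0⁻¹ = 0`, this is the pseudo-inverse of `R`; no invertibility is needed.
  set G := cfc (fun x : ℝ => x⁻¹) R with hG
  have hGH : Gᴴ = G := cfc_predicate (R := ℝ) (fun x : ℝ => x⁻¹) R
  have hRGR : R * G * R = R := by
    conv_lhs => rw [← cfc_id' ℝ R, hG, ← cfc_mul _ _ _ (hc _) (hc _),
      ← cfc_mul _ _ _ (hc _) (hc _)]
    conv_rhs => rw [← cfc_id' ℝ R]
    exact cfc_congr fun x _ => mul_inv_mul_cancel x
  have hGRG : G * R * G = G := by
    conv_lhs => rw [← cfc_id' ℝ R, hG, ← cfc_mul _ _ _ (hc _) (hc _),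
      ← cfc_mul _ _ _ (hc _) (hc _)]
    rw [hG]
    refine cfc_congr fun x _ => ?_
    simpa using mul_inv_mul_cancel x⁻¹
  have hKG : K = R * G * K := by
    rw [← sub_eq_zero, ← Matrix.self_mul_conjTranspose_eq_zero]
    have : (K - R * G * K) = (1 - R * G) * K := by rw [Matrix.sub_mul, Matrix.one_mul]
    rw [this, Matrix.conjTranspose_mul, Matrix.mul_assoc, ← Matrix.mul_assoc K, h,
      ← Matrix.mul_assoc, Matrix.sub_mul, Matrix.one_mul, hRGR, sub_self, Matrix.zero_mul]
  refine ⟨Φᴴ * G * K, ?_, ?_⟩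
  · rw [← Matrix.mul_assoc, ← Matrix.mul_assoc, ← hR]
    exact hKG
  · have hW : Φᴴ * G * K * (Φᴴ * G * K)ᴴ = Φᴴ * G * Φ := by
      calc Φᴴ * G * K * (Φᴴ * G * K)ᴴ = Φᴴ * (G * (K * Kᴴ) * G) * Φ := by
            simp only [Matrix.conjTranspose_mul, Matrix.conjTranspose_conjTranspose, hGH,
              Matrix.mul_assoc]
        _ = _ := by rw [h, hGRG]
    have hQ : Φᴴ * G * Φ * (Φᴴ * G * Φ) = Φᴴ * G * Φ := by
      calc Φᴴ * G * Φ * (Φᴴ * G * Φ) = Φᴴ * (G * R * G) * Φ := by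
            simp only [hR, Matrix.mul_assoc]
        _ = _ := by rw [hGRG]
    have hQH : (Φᴴ * G * Φ)ᴴ = Φᴴ * G * Φ := by
      simp only [Matrix.conjTranspose_mul, Matrix.conjTranspose_conjTranspose, hGH,
        Matrix.mul_assoc]
    rw [hW]
    -- `Φᴴ * G * Φ` is an orthogonal projection, hence so is its complement.
    have : 1 - Φᴴ * G * Φ = (1 - Φᴴ * G * Φ) * (1 - Φᴴ * G * Φ)ᴴ := by
      rw [Matrix.conjTranspose_sub, Matrix.conjTranspose_one, hQH, Matrix.sub_mul,
        Matrix.mul_sub, Matrix.mul_sub, hQ]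
      simp
    rw [this]
    exact Matrix.posSemidef_self_mul_conjTranspose _

/-! ### Partial traces and rank-one operators. -/

section PartialTrace

variable {A B : Type*}

lemma ketbra_smul (c : ℂ) (χ : A → ℂ) : ketbra (c • χ) = (c * star c) • ketbra χ := by
  ext i j
  simp only [ketbra, Matrix.vecMulVec_apply, Pi.smul_apply, Pi.star_apply, Matrix.smul_apply,
    smul_eq_mul, star_mul']
  ring

lemma traceSnd_sum [Fintype B] {ι : Type*} (s : Finset ι) (σ : ι → Matrix (A × B) (A × B) ℂ) :
    traceSnd (∑ i ∈ s, σ i) = ∑ i ∈ s, traceSnd (σ i) := by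
  ext a a'
  simp only [traceSnd, Matrix.of_apply, Matrix.sum_apply]
  exact Finset.sum_comm

lemma traceSnd_smul [Fintype B] (c : ℂ) (σ : Matrix (A × B) (A × B) ℂ) :
    traceSnd (c • σ) = c • traceSnd σ := by
  ext a a'
  simp [traceSnd, Finset.mul_sum]

lemma traceSnd_zero [Fintype B] : traceSnd (0 : Matrix (A × B) (A × B) ℂ) = 0 := by
  simpa using traceSnd_smul 0 (0 : Matrix (A × B) (A × B) ℂ)

lemma posSemidef_traceSnd [Fintype B] {σ : Matrix (A × B) (A × B) ℂ} (h : σ.PosSemidef) :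
    (traceSnd σ).PosSemidef := by
  have : traceSnd σ = ∑ b, σ.submatrix (fun a => (a, b)) (fun a => (a, b)) := by
    ext a a'
    simp [traceSnd, Matrix.sum_apply]
  rw [this]
  exact Matrix.posSemidef_sum _ fun b _ => h.submatrix _

variable [Fintype A] [Fintype B]

lemma trace_traceSnd (σ : Matrix (A × B) (A × B) ℂ) : (traceSnd σ).trace = σ.trace := by
  simp [traceSnd, Matrix.trace, Fintype.sum_prod_type]

lemma trace_ketbra (χ : A → ℂ) : (ketbra χ).trace = ((∑ a, ‖χ a‖ ^ 2 : ℝ) : ℂ) := by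
  simp [ketbra, Matrix.trace, Matrix.vecMulVec_apply, Complex.mul_conj']

lemma posSemidef_ketbra (χ : A → ℂ) : (ketbra χ).PosSemidef :=
  Matrix.posSemidef_vecMulVec_self_star χ

end PartialTrace

lemma sum_ketbra_col {m k : Type*} [Fintype k] (K : Matrix m k ℂ) :
    K * Kᴴ = ∑ i, ketbra (fun a => K a i) := by
  ext a a'
  simp [ketbra, Matrix.mul_apply, Matrix.sum_apply, Matrix.vecMulVec_apply]

lemma exists_eq_sum_ketbra {B : Type*} [Fintype B] [DecidableEq B] {M : Matrix B B ℂ}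
    (h : M.PosSemidef) : ∃ w : B → B → ℂ, M = ∑ k, ketbra (w k) := by
  obtain ⟨N, hN⟩ := CStarAlgebra.nonneg_iff_eq_star_mul_self.mp h.nonneg
  refine ⟨fun k b => Nᴴ b k, ?_⟩
  rw [← sum_ketbra_col, Matrix.conjTranspose_conjTranspose]
  exact hN

/-- A rank-one resolution of the identity is inserted between `Φ` and `Φᴴ`. The conjugates `star (w
i)` also resolve the identity, by transposition; they are the vectors that appear when `Y` is
measured. -/
lemma sum_ketbra_mulVec {ι Z Y : Type*} [Fintype ι] [Fintype Y] [DecidableEq Y] (Φ : Matrix Z Y ℂ)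
    (w : ι → Y → ℂ) (hw : ∑ i, ketbra (w i) = 1) :
    Φ * Φᴴ = ∑ i, ketbra (Φ.mulVec (star (w i))) := by
  have h1 : ∀ v : Y → ℂ, ketbra (Φ.mulVec v) = Φ * ketbra v * Φᴴ := fun v => by
    rw [ketbra, ketbra, Matrix.mul_vecMulVec, Matrix.vecMulVec_mul, Matrix.star_mulVec]
  have h2 : ∑ i, ketbra (star (w i)) = 1 := by
    have := congrArg Matrix.transpose hw
    rw [Matrix.transpose_one, Matrix.transpose_sum] at this
    rw [← this]
    refine Finset.sum_congr rfl fun i _ => ?_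
    ext a b
    simp [ketbra, Matrix.vecMulVec_apply, mul_comm]
  simp_rw [h1]
  rw [← Matrix.sum_mul, ← Matrix.mul_sum, h2, Matrix.mul_one]

/-! ### Pure-state decompositions, normalized and unnormalized. -/

section Decomposition

variable {A B : Type*} [Fintype A] [Fintype B] [DecidableEq A]

/-- The zero vector must also receive a unit vector, hence `Nonempty`. -/
lemma eq_smul_unit {A : Type*} [Fintype A] [Nonempty A] (χ : A → ℂ) :
    ∃ ψ : A → ℂ, ∑ a, ‖ψ a‖ ^ 2 = 1 ∧
      χ = ((Real.sqrt (∑ a, ‖χ a‖ ^ 2) : ℝ) : ℂ) • ψ := by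
  classical
  set t := ∑ a, ‖χ a‖ ^ 2 with ht
  have ht0 : 0 ≤ t := Finset.sum_nonneg fun _ _ => sq_nonneg _
  rcases ht0.eq_or_lt with h0 | hpos
  · have hχ : χ = 0 := by
      funext a
      have := (Finset.sum_eq_zero_iff_of_nonneg fun i _ => sq_nonneg ‖χ i‖).mp
        (ht.symm.trans h0.symm) a (Finset.mem_univ a)
      simpa using this
    obtain ⟨a₀⟩ := ‹Nonempty A›
    refine ⟨Pi.single a₀ 1, ?_, by simp [← h0, hχ]⟩
    rw [Finset.sum_eq_single a₀] <;> simp +contextual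
  · have hs : Real.sqrt t ≠ 0 := (Real.sqrt_pos.mpr hpos).ne'
    refine ⟨((Real.sqrt t : ℝ) : ℂ)⁻¹ • χ, ?_, ?_⟩
    · simp only [Pi.smul_apply, smul_eq_mul, norm_mul, norm_inv, Complex.norm_real, mul_pow,
        inv_pow, Real.norm_eq_abs, sq_abs, Real.sq_sqrt ht0]
      rw [← Finset.mul_sum, ← ht, inv_mul_cancel₀ hpos.ne']
    · rw [smul_smul, mul_inv_cancel₀ (by exact_mod_cast hs), one_smul]

lemma weightedEntropy_traceSnd_ketbra_smul {p : ℝ} (hp : 0 ≤ p) {ψ : A × B → ℂ}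
    (hψ : ∑ a, ‖ψ a‖ ^ 2 = 1) :
    weightedEntropy (traceSnd (ketbra (((Real.sqrt p : ℝ) : ℂ) • ψ))) =
      p * entropy (traceSnd (ketbra ψ)) := by
  have h1 : ketbra (((Real.sqrt p : ℝ) : ℂ) • ψ) = (p : ℂ) • ketbra ψ := by
    rw [ketbra_smul, Complex.star_def, Complex.conj_ofReal, ← Complex.ofReal_mul,
      Real.mul_self_sqrt hp]
  have ht : (traceSnd ((p : ℂ) • ketbra ψ)).trace.re = p := by
    rw [trace_traceSnd, Matrix.trace_smul, trace_ketbra, hψ]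
    simp
  rw [h1, weightedEntropy, ht, traceSnd_smul, smul_smul]
  by_cases h0 : p = 0
  · simp [h0]
  · rw [inv_mul_cancel₀ (by exact_mod_cast h0), one_smul]

/-- A decomposition into unnormalized pure states can be normalized. -/
lemma exists_isPureDecomposition {ρ : Matrix (A × B) (A × B) ℂ} (hρ : ρ.trace = 1)
    {ι : Type*} [Fintype ι] {χ : ι → A × B → ℂ} (hχ : ρ = ∑ i, ketbra (χ i)) :
    ∃ (n : ℕ) (p : Fin n → ℝ) (ψ : Fin n → A × B → ℂ), IsPureDecomposition ρ p ψ ∧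
      ∑ i, weightedEntropy (traceSnd (ketbra (χ i))) =
        ∑ i, p i * entropy (traceSnd (ketbra (ψ i))) := by
  have : Nonempty (A × B) := by
    by_contra hne
    rw [not_nonempty_iff] at hne
    simp [Matrix.trace] at hρ
  choose ψ hψ hχψ using fun i => eq_smul_unit (χ i)
  set p : ι → ℝ := fun i => ∑ a, ‖χ i a‖ ^ 2 with hp
  have hp0 : ∀ i, 0 ≤ p i := fun i => Finset.sum_nonneg fun _ _ => sq_nonneg _
  let e := (Fintype.equivFin ι).symm
  refine ⟨Fintype.card ι, p ∘ e, ψ ∘ e, ⟨fun i => hp0 _, ?_, fun i => hψ _, ?_⟩, ?_⟩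
  · rw [Function.comp_def, e.sum_comp p]
    have h := congrArg Complex.re (congrArg Matrix.trace hχ)
    rw [hρ, Matrix.trace_sum, Complex.re_sum] at h
    simpa [trace_ketbra, -Complex.ofReal_sum, -Complex.ofReal_pow] using h.symm
  · rw [hχ]
    simp only [Function.comp_apply]
    rw [e.sum_comp fun i => (p i : ℂ) • ketbra (ψ i)]
    refine Finset.sum_congr rfl fun i _ => ?_
    conv_lhs => rw [hχψ i]
    rw [ketbra_smul, Complex.star_def, Complex.conj_ofReal, ← Complex.ofReal_mul,
      Real.mul_self_sqrt (hp0 i)]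
  · simp only [Function.comp_apply]
    rw [e.sum_comp fun i => p i * entropy (traceSnd (ketbra (ψ i)))]
    refine Finset.sum_congr rfl fun i _ => ?_
    conv_lhs => rw [hχψ i]
    exact weightedEntropy_traceSnd_ketbra_smul (hp0 i) (hψ i)

lemma IsPureDecomposition.exists_ketbra {ρ : Matrix (A × B) (A × B) ℂ} {n : ℕ} {p : Fin n → ℝ}
    {ψ : Fin n → A × B → ℂ} (h : IsPureDecomposition ρ p ψ) :
    ∃ χ : Fin n → A × B → ℂ, ρ = ∑ i, ketbra (χ i) ∧
      ∑ i, weightedEntropy (traceSnd (ketbra (χ i))) =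
        ∑ i, p i * entropy (traceSnd (ketbra (ψ i))) := by
  refine ⟨fun i => ((Real.sqrt (p i) : ℝ) : ℂ) • ψ i, ?_, Finset.sum_congr rfl fun i _ =>
    weightedEntropy_traceSnd_ketbra_smul (h.prob_nonneg i) (h.unit i)⟩
  rw [h.sum_eq]
  refine Finset.sum_congr rfl fun i _ => ?_
  rw [ketbra_smul, Complex.star_def, Complex.conj_ofReal, ← Complex.ofReal_mul,
    Real.mul_self_sqrt (h.prob_nonneg i)]

lemma bddBelow_average_entropy (ρ : Matrix (A × B) (A × B) ℂ) :
    BddBelow {r : ℝ | ∃ (n : ℕ) (p : Fin n → ℝ) (ψ : Fin n → A × B → ℂ),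
      IsPureDecomposition ρ p ψ ∧ r = ∑ i, p i * entropy (traceSnd (ketbra (ψ i)))} := by
  refine ⟨0, ?_⟩
  rintro r ⟨n, p, ψ, h, rfl⟩
  refine Finset.sum_nonneg fun i _ => mul_nonneg (h.prob_nonneg i) ?_
  refine entropy_nonneg (posSemidef_traceSnd (posSemidef_ketbra _)) ?_
  rw [trace_traceSnd, trace_ketbra, h.unit i]
  simp

end Decomposition

/-! ### Steering and the Koashi–Winter relation. -/

section KoashiWinter

lemma outcomeState_apply {A B : Type*} [Fintype A] [Fintype B] [DecidableEq A]
    (ρ : Matrix (A × B) (A × B) ℂ) (M : Matrix B B ℂ) (a a' : A) :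
    outcomeState ρ M a a' = ∑ y, ∑ y', M y y' * ρ (a, y') (a', y) := by
  simp only [outcomeState, traceSnd, Matrix.of_apply, Matrix.mul_apply, Fintype.sum_prod_type,
    Matrix.kronecker, Matrix.kroneckerMap_apply, Matrix.one_apply, ite_mul, one_mul, zero_mul]
  refine Finset.sum_congr rfl fun y _ => ?_
  rw [Finset.sum_eq_single a] <;> simp +contextual [eq_comm]

lemma outcomeState_sum {A B : Type*} [Fintype A] [Fintype B] [DecidableEq A]
    (ρ : Matrix (A × B) (A × B) ℂ) {ι : Type*} [Fintype ι] (M : ι → Matrix B B ℂ) :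
    outcomeState ρ (∑ i, M i) = ∑ i, outcomeState ρ (M i) := by
  ext a a'
  simp only [outcomeState_apply, Matrix.sum_apply, Finset.sum_mul]
  rw [Finset.sum_comm (s := (Finset.univ : Finset ι))]
  refine Finset.sum_congr rfl fun y _ => ?_
  exact Finset.sum_comm

lemma measuredInfo_eq {A B : Type*} [Fintype A] [Fintype B] [DecidableEq A]
    (ρ : Matrix (A × B) (A × B) ℂ) {n : ℕ} (M : Fin n → Matrix B B ℂ) :
    measuredInfo ρ M =
      entropy (traceSnd ρ) - ∑ i, weightedEntropy (outcomeState ρ (M i)) := by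
  have : ∀ i, outcomeProb ρ (M i) = (outcomeState ρ (M i)).trace.re := fun i => by
    rw [outcomeState, trace_traceSnd, outcomeProb]
  simp only [measuredInfo, weightedEntropy, this]

variable {A X Y : Type*} [Fintype A] [Fintype X] [Fintype Y] [DecidableEq A]

/-- The marginal on `AY` of the pure state of `AXY` with amplitudes `Φ`. -/
def complementMarginal (Φ : Matrix (A × X) Y ℂ) : Matrix (A × Y) (A × Y) ℂ :=
  Matrix.of fun p q => ∑ x, Φ (p.1, x) p.2 * star (Φ (q.1, x) q.2)

/-- Steering: the effect `ketbra w` on `Y` leaves `AX` in the unnormalized pure state `Φ.mulVec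
(star w)`, of which only the `A` part is seen here. -/
lemma outcomeState_ketbra (Φ : Matrix (A × X) Y ℂ) (w : Y → ℂ) :
    outcomeState (complementMarginal Φ) (ketbra w) = traceSnd (ketbra (Φ.mulVec (star w))) := by
  ext a a'
  simp only [outcomeState_apply, complementMarginal, traceSnd, ketbra, Matrix.of_apply,
    Matrix.vecMulVec_apply, Pi.star_apply, Matrix.mulVec, dotProduct, star_sum, star_mul',
    star_star, Finset.sum_mul_sum]
  simp only [Finset.mul_sum]
  have (x : X) := Finset.sum_comm (s := Finset.univ) (t := Finset.univ)
    (f := fun y' y => Φ (a, x) y' * star (w y') * (star (Φ (a', x) y) * w y))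
  simp_rw [this]
  rw [Finset.sum_comm (s := (Finset.univ : Finset X))]
  refine Finset.sum_congr rfl fun y _ => ?_
  rw [Finset.sum_comm (s := (Finset.univ : Finset X))]
  refine Finset.sum_congr rfl fun y' _ => Finset.sum_congr rfl fun x _ => ?_
  ring

variable [DecidableEq Y]

/-- Splitting each effect into rank-one pieces steers `AX` to pure states, and superadditivity of
the weighted entropy says that this refinement cannot raise the average. -/
lemma exists_average_le_of_measurement (Φ : Matrix (A × X) Y ℂ) {n : ℕ}
    {M : Fin n → Matrix Y Y ℂ} (hM : IsMeasurement M) :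
    ∃ χ : Fin n × Y → A × X → ℂ, Φ * Φᴴ = ∑ i, ketbra (χ i) ∧
      ∑ i, weightedEntropy (traceSnd (ketbra (χ i))) ≤
        ∑ i, weightedEntropy (outcomeState (complementMarginal Φ) (M i)) := by
  choose w hw using fun i => exists_eq_sum_ketbra (hM.posSemidef i)
  refine ⟨fun j => Φ.mulVec (star (w j.1 j.2)), ?_, ?_⟩
  · refine sum_ketbra_mulVec Φ (fun j : Fin n × Y => w j.1 j.2) ?_
    rw [Fintype.sum_prod_type, ← hM.sum_eq_one]
    exact Finset.sum_congr rfl fun i _ => (hw i).symm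
  · rw [Fintype.sum_prod_type]
    refine Finset.sum_le_sum fun i _ => ?_
    rw [hw i, outcomeState_sum]
    simp only [outcomeState_ketbra]
    exact sum_weightedEntropy_le _ fun k => posSemidef_traceSnd (posSemidef_ketbra _)

/-- The contraction `W` taking `Φ` to the decomposition supplies rank-one effects from its
conjugated columns. They sum to at most 1, so one extra effect completes the measurement; it occurs
with probability zero. -/
lemma exists_measurement_of_decomposition [DecidableEq X] (Φ : Matrix (A × X) Y ℂ) {n : ℕ}
    {χ : Fin n → A × X → ℂ} (hχ : Φ * Φᴴ = ∑ i, ketbra (χ i)) :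
    ∃ M : Fin (n + 1) → Matrix Y Y ℂ, IsMeasurement M ∧
      ∑ i, weightedEntropy (outcomeState (complementMarginal Φ) (M i)) =
        ∑ i, weightedEntropy (traceSnd (ketbra (χ i))) := by
  set K : Matrix (A × X) (Fin n) ℂ := Matrix.of fun a i => χ i a with hK
  have hKK : K * Kᴴ = Φ * Φᴴ := by
    rw [sum_ketbra_col, hχ]
    rfl
  obtain ⟨W, hW, hpos⟩ := exists_contraction_factor Φ K hKK
  have hcol : ∀ i, Φ.mulVec (fun y => W y i) = χ i := fun i => by
    funext a
    have := congrFun (congrFun hW a) i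
    simpa [hK, Matrix.mul_apply, Matrix.mulVec, dotProduct] using this.symm
  set w : Fin n → Y → ℂ := fun i => star fun y => W y i with hw
  set M₀ : Matrix Y Y ℂ := 1 - ∑ i, ketbra (w i) with hM₀
  have hM₀T : M₀ = (1 - W * Wᴴ)ᵀ := by
    rw [hM₀, Matrix.transpose_sub, Matrix.transpose_one]
    congr 1
    ext a b
    simp [hw, ketbra, Matrix.sum_apply, Matrix.mul_apply, Matrix.vecMulVec_apply, mul_comm]
  have hM₀pos : M₀.PosSemidef := hM₀T ▸ hpos.transpose
  have hM : ∀ i, outcomeState (complementMarginal Φ) (ketbra (w i)) = traceSnd (ketbra (χ i)) := by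
    intro i
    rw [outcomeState_ketbra, hw, star_star, hcol]
  -- The completed family also decomposes `Φ * Φᴴ`, which the `χ i` already exhaust, so the part
  -- steered by `M₀` vanishes.
  have hzero : outcomeState (complementMarginal Φ) M₀ = 0 := by
    obtain ⟨v, hv⟩ := exists_eq_sum_ketbra hM₀pos
    have h1 : Φ * Φᴴ = ∑ i, ketbra (χ i) + ∑ k, ketbra (Φ.mulVec (star (v k))) := by
      have := sum_ketbra_mulVec Φ (Sum.elim w v)
        (by rw [Fintype.sum_sum_type]; simp only [Sum.elim_inl, Sum.elim_inr]
            rw [← hv, hM₀, add_sub_cancel])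
      rw [this, Fintype.sum_sum_type]
      simp only [Sum.elim_inl, Sum.elim_inr, hw, star_star, hcol]
    rw [← hχ, left_eq_add] at h1
    rw [hv, outcomeState_sum]
    simp only [outcomeState_ketbra]
    rw [← traceSnd_sum, h1, traceSnd_zero]
  refine ⟨Fin.cons M₀ fun i => ketbra (w i), ⟨?_, ?_⟩, ?_⟩
  · exact Fin.cases hM₀pos fun i => posSemidef_ketbra _
  · rw [Fin.sum_univ_succ]
    simp only [Fin.cons_zero, Fin.cons_succ]
    rw [hM₀, sub_add_cancel]
  · rw [Fin.sum_univ_succ]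
    simp only [Fin.cons_zero, Fin.cons_succ, hzero, hM]
    simp [weightedEntropy]

/-- The **Koashi–Winter relation**: for a pure state of `AXY`, the information about `A` that can
be gained by measuring `Y` is the entropy of `A` minus the entanglement of formation of `AX`. -/
theorem isLUB_measuredInfo [DecidableEq X] (Φ : Matrix (A × X) Y ℂ) (hΦ : (Φ * Φᴴ).trace = 1) :
    IsLUB {r : ℝ | ∃ (n : ℕ) (M : Fin n → Matrix Y Y ℂ), IsMeasurement M ∧
        r = measuredInfo (complementMarginal Φ) M}
      (entropy (traceSnd (complementMarginal Φ)) - eof (Φ * Φᴴ)) := by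
  constructor
  · rintro r ⟨n, M, hM, rfl⟩
    obtain ⟨χ, hχ, hle⟩ := exists_average_le_of_measurement Φ hM
    obtain ⟨m, p, ψ, hd, heq⟩ := exists_isPureDecomposition hΦ hχ
    have := csInf_le (bddBelow_average_entropy (Φ * Φᴴ)) ⟨m, p, ψ, hd, rfl⟩
    rw [measuredInfo_eq, eof]
    linarith
  · intro b hb
    rw [sub_le_comm]
    refine le_csInf ?_ ?_
    -- The columns of `Φ` provide a decomposition, so the infimum is over a nonempty set.
    · obtain ⟨m, p, ψ, hd, -⟩ := exists_isPureDecomposition hΦ (sum_ketbra_col Φ)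
      exact ⟨_, m, p, ψ, hd, rfl⟩
    · rintro r ⟨n, p, ψ, hd, rfl⟩
      obtain ⟨χ, hχ, heq⟩ := hd.exists_ketbra
      obtain ⟨M, hM, hMeq⟩ := exists_measurement_of_decomposition Φ hχ
      have := hb ⟨_, M, hM, rfl⟩
      rw [measuredInfo_eq] at this
      linarith

lemma nonempty_measuredInfo (ρ : Matrix (A × Y) (A × Y) ℂ) :
    {r : ℝ | ∃ (n : ℕ) (M : Fin n → Matrix Y Y ℂ), IsMeasurement M ∧
      r = measuredInfo ρ M}.Nonempty :=
  ⟨_, 1, fun _ => 1, ⟨fun _ => Matrix.PosSemidef.one, by simp⟩, rfl⟩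

lemma classicalCorr_complementMarginal [DecidableEq X] (Φ : Matrix (A × X) Y ℂ)
    (hΦ : (Φ * Φᴴ).trace = 1) :
    classicalCorr (complementMarginal Φ) =
      entropy (traceSnd (complementMarginal Φ)) - eof (Φ * Φᴴ) :=
  (isLUB_measuredInfo Φ hΦ).csSup_eq (nonempty_measuredInfo _)

lemma eof_sub_discord [DecidableEq X] (Φ : Matrix (A × X) Y ℂ) (hΦ : (Φ * Φᴴ).trace = 1) :
    eof (Φ * Φᴴ) - discord (complementMarginal Φ) =
      entropy (complementMarginal Φ) - entropy (traceFst (complementMarginal Φ)) := by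
  rw [discord, mutualInfo, classicalCorr_complementMarginal Φ hΦ]
  ring

/-- The marginals of a pure state on `Y` and `AX` are `(Φᴴ * Φ)ᵀ` and `Φ * Φᴴ`, which share their
nonzero spectrum. -/
lemma entropy_traceFst_complementMarginal [DecidableEq X] (Φ : Matrix (A × X) Y ℂ) :
    entropy (traceFst (complementMarginal Φ)) = entropy (Φ * Φᴴ) := by
  rw [entropy_mul_conjTranspose, ← entropy_transpose (Matrix.isHermitian_conjTranspose_mul_self Φ)]
  congr 1
  ext y y'
  simp [traceFst, complementMarginal, Matrix.mul_apply, Fintype.sum_prod_type, mul_comm]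

end KoashiWinter

/-! ### The four bipartitions of the purification. -/

section Purification

variable {A B C E : Type*}

/-- Amplitudes of a vector of `ABCE`, in the bipartition `ABE|C`. -/
def ampABE (ψ : A × B × C × E → ℂ) : Matrix (A × (B × E)) C ℂ :=
  Matrix.of fun x c => ψ (x.1, x.2.1, c, x.2.2)

/-- Amplitudes of a vector of `ABCE`, in the bipartition `ACE|B`. -/
def ampACE (ψ : A × B × C × E → ℂ) : Matrix (A × (C × E)) B ℂ :=
  Matrix.of fun x b => ψ (x.1, b, x.2.1, x.2.2)

/-- Amplitudes of a vector of `ABCE`, in the bipartition `AB|CE`. -/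
def ampAB (ψ : A × B × C × E → ℂ) : Matrix (A × B) (C × E) ℂ :=
  Matrix.of fun x y => ψ (x.1, x.2, y.1, y.2)

/-- Amplitudes of a vector of `ABCE`, in the bipartition `AC|BE`. -/
def ampAC (ψ : A × B × C × E → ℂ) : Matrix (A × C) (B × E) ℂ :=
  Matrix.of fun x y => ψ (x.1, y.1, x.2, y.2)

lemma margABE_eq [Fintype C] (ψ : A × B × C × E → ℂ) :
    margABE ψ = ampABE ψ * (ampABE ψ)ᴴ := by
  ext x y
  simp [margABE, ampABE, ketbra, Matrix.mul_apply, Matrix.vecMulVec_apply]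

lemma margACE_eq [Fintype B] (ψ : A × B × C × E → ℂ) :
    margACE ψ = ampACE ψ * (ampACE ψ)ᴴ := by
  ext x y
  simp [margACE, ampACE, ketbra, Matrix.mul_apply, Matrix.vecMulVec_apply]

lemma margABE_eq_complementMarginal [Fintype C] (ψ : A × B × C × E → ℂ) :
    margABE ψ = complementMarginal (ampAC ψ) := by
  ext x y
  simp [margABE, ampAC, complementMarginal, ketbra, Matrix.vecMulVec_apply]

lemma margACE_eq_complementMarginal [Fintype B] (ψ : A × B × C × E → ℂ) :
    margACE ψ = complementMarginal (ampAB ψ) := by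
  ext x y
  simp [margACE, ampAB, complementMarginal, ketbra, Matrix.vecMulVec_apply]

variable [Fintype E] {ρ : Matrix (A × B × C) (A × B × C) ℂ} {ψ : A × B × C × E → ℂ}

lemma IsPurification.margAB_eq [Fintype C] (h : IsPurification ψ ρ) :
    margAB ρ = ampAB ψ * (ampAB ψ)ᴴ := by
  ext x y
  simp [margAB, ampAB, h _ _ _ _ _ _, ketbra, Matrix.mul_apply, Matrix.vecMulVec_apply,
    Fintype.sum_prod_type]

lemma IsPurification.margAC_eq [Fintype B] (h : IsPurification ψ ρ) :
    margAC ρ = ampAC ψ * (ampAC ψ)ᴴ := by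
  ext x y
  simp [margAC, ampAC, h _ _ _ _ _ _, ketbra, Matrix.mul_apply, Matrix.vecMulVec_apply,
    Fintype.sum_prod_type]

lemma IsPurification.margAB_eq_complementMarginal [Fintype C] (h : IsPurification ψ ρ) :
    margAB ρ = complementMarginal (ampACE ψ) := by
  ext x y
  simp [margAB, ampACE, h _ _ _ _ _ _, ketbra, complementMarginal, Matrix.vecMulVec_apply,
    Fintype.sum_prod_type]

lemma IsPurification.margAC_eq_complementMarginal [Fintype B] (h : IsPurification ψ ρ) :
    margAC ρ = complementMarginal (ampABE ψ) := by
  ext x y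
  simp [margAC, ampABE, h _ _ _ _ _ _, ketbra, complementMarginal, Matrix.vecMulVec_apply,
    Fintype.sum_prod_type]

variable [Fintype A] [Fintype B] [Fintype C]

lemma IsPurification.sum_eq_one (h : IsPurification ψ ρ) (hρ : ρ.trace = 1) :
    ∑ a, ∑ b, ∑ c, ∑ e, ψ (a, b, c, e) * star (ψ (a, b, c, e)) = 1 := by
  rw [← hρ]
  simp [Matrix.trace, Fintype.sum_prod_type, h _ _ _ _ _ _, ketbra, Matrix.vecMulVec_apply]

lemma IsPurification.trace_ampAB (h : IsPurification ψ ρ) (hρ : ρ.trace = 1) :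
    (ampAB ψ * (ampAB ψ)ᴴ).trace = 1 := by
  rw [← h.sum_eq_one hρ]
  simp [Matrix.trace, Matrix.mul_apply, ampAB, Fintype.sum_prod_type]

lemma IsPurification.trace_ampAC (h : IsPurification ψ ρ) (hρ : ρ.trace = 1) :
    (ampAC ψ * (ampAC ψ)ᴴ).trace = 1 := by
  rw [← h.sum_eq_one hρ]
  simp only [Matrix.trace, Matrix.diag_apply, Matrix.mul_apply, ampAC, Fintype.sum_prod_type,
    Matrix.of_apply, Matrix.conjTranspose_apply]
  exact Finset.sum_congr rfl fun a _ => Finset.sum_comm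

lemma IsPurification.trace_ampABE (h : IsPurification ψ ρ) (hρ : ρ.trace = 1) :
    (ampABE ψ * (ampABE ψ)ᴴ).trace = 1 := by
  rw [← h.sum_eq_one hρ]
  simp only [Matrix.trace, Matrix.diag_apply, Matrix.mul_apply, ampABE, Fintype.sum_prod_type,
    Matrix.of_apply, Matrix.conjTranspose_apply]
  exact Finset.sum_congr rfl fun a _ => Finset.sum_congr rfl fun b _ => Finset.sum_comm

lemma IsPurification.trace_ampACE (h : IsPurification ψ ρ) (hρ : ρ.trace = 1) :
    (ampACE ψ * (ampACE ψ)ᴴ).trace = 1 := by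
  rw [← h.trace_ampAC hρ]
  simp only [Matrix.trace, Matrix.diag_apply, Matrix.mul_apply, ampACE, ampAC,
    Fintype.sum_prod_type, Matrix.of_apply, Matrix.conjTranspose_apply]
  exact Finset.sum_congr rfl fun a _ => Finset.sum_congr rfl fun c _ => Finset.sum_comm

end Purification

/-! ### Monotonicity under discarding part of the measured system. -/

section LocalMonotonicity

/-- Partial trace over the last factor of the second subsystem. -/
def traceAux {A Y E : Type*} [Fintype E] (σ : Matrix (A × (Y × E)) (A × (Y × E)) ℂ) :
    Matrix (A × Y) (A × Y) ℂ :=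
  Matrix.of fun p q => ∑ e, σ (p.1, p.2, e) (q.1, q.2, e)

lemma outcomeState_kronecker_one {A Y E : Type*} [Fintype A] [Fintype Y] [Fintype E]
    [DecidableEq A] [DecidableEq E] (σ : Matrix (A × (Y × E)) (A × (Y × E)) ℂ)
    (M : Matrix Y Y ℂ) :
    outcomeState σ (Matrix.kronecker M (1 : Matrix E E ℂ)) = outcomeState (traceAux σ) M := by
  ext a a'
  simp only [outcomeState_apply, traceAux, Matrix.of_apply, Matrix.kronecker,
    Matrix.kroneckerMap_apply, Fintype.sum_prod_type, Matrix.one_apply, mul_ite, mul_one, mul_zero,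
    ite_mul, zero_mul, Finset.sum_ite_eq, Finset.mem_univ, if_true, Finset.mul_sum]
  exact Finset.sum_congr rfl fun y _ => Finset.sum_comm

lemma traceSnd_traceAux {A Y E : Type*} [Fintype Y] [Fintype E]
    (σ : Matrix (A × (Y × E)) (A × (Y × E)) ℂ) :
    traceSnd (traceAux σ) = traceSnd σ := by
  ext a a'
  simp [traceSnd, traceAux, Fintype.sum_prod_type]

variable {A Y E : Type*} [Fintype A] [Fintype Y] [Fintype E] [DecidableEq A] [DecidableEq Y]
  [DecidableEq E]

/-- A measurement of `Y` is also a measurement of `YE`, giving the same information. -/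
lemma exists_measurement_extension (σ : Matrix (A × (Y × E)) (A × (Y × E)) ℂ) {n : ℕ}
    {M : Fin n → Matrix Y Y ℂ} (hM : IsMeasurement M) :
    ∃ N : Fin n → Matrix (Y × E) (Y × E) ℂ, IsMeasurement N ∧
      measuredInfo (traceAux σ) M = measuredInfo σ N := by
  refine ⟨fun i => Matrix.kronecker (M i) 1,
    ⟨fun i => (hM.posSemidef i).kronecker Matrix.PosSemidef.one, ?_⟩, ?_⟩
  · have : (1 : Matrix (Y × E) (Y × E) ℂ) = Matrix.kronecker (1 : Matrix Y Y ℂ) 1 :=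
      Matrix.one_kronecker_one.symm
    rw [this, ← hM.sum_eq_one]
    ext p q
    simp [Matrix.sum_apply, Matrix.kronecker, Finset.sum_mul]
  · simp only [measuredInfo_eq, outcomeState_kronecker_one, traceSnd_traceAux]

lemma classicalCorr_traceAux_le (σ : Matrix (A × (Y × E)) (A × (Y × E)) ℂ)
    (hσ : BddAbove {r : ℝ | ∃ (n : ℕ) (M : Fin n → Matrix (Y × E) (Y × E) ℂ),
      IsMeasurement M ∧ r = measuredInfo σ M}) :
    classicalCorr (traceAux σ) ≤ classicalCorr σ := by
  refine csSup_le (nonempty_measuredInfo _) ?_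
  rintro r ⟨n, M, hM, rfl⟩
  obtain ⟨N, hN, heq⟩ := exists_measurement_extension σ hM
  exact le_csSup hσ ⟨n, N, hN, heq⟩

/-- Entanglement of formation does not increase when a part `E` of the second
subsystem is discarded into the environment. -/
lemma eof_le_of_traceAux {X X' : Type*} [Fintype X] [Fintype X'] [DecidableEq X] [DecidableEq X']
    (Φ : Matrix (A × X) (Y × E) ℂ) (hΦ : (Φ * Φᴴ).trace = 1)
    (Φ' : Matrix (A × X') Y ℂ) (hΦ' : (Φ' * Φ'ᴴ).trace = 1)
    (h : complementMarginal Φ' = traceAux (complementMarginal Φ)) :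
    eof (Φ * Φᴴ) ≤ eof (Φ' * Φ'ᴴ) := by
  -- Koashi–Winter supplies the upper bound that makes the supremum meaningful; since S(A) is common
  -- to both sides, the inequality reverses for the entanglement of formation.
  have h1 := classicalCorr_traceAux_le (complementMarginal Φ) (isLUB_measuredInfo Φ hΦ).bddAbove
  have h2 := classicalCorr_complementMarginal Φ' hΦ'
  rw [h, traceSnd_traceAux] at h2
  rw [h2, classicalCorr_complementMarginal Φ hΦ] at h1
  linarith

end LocalMonotonicity

lemma complementMarginal_ampABE {A B C E : Type*} [Fintype B] [Fintype E]
    (ψ : A × B × C × E → ℂ) :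
    complementMarginal (ampABE ψ) = traceAux (complementMarginal (ampAB ψ)) := by
  ext p q
  simp only [complementMarginal, ampABE, ampAB, traceAux, Matrix.of_apply, Fintype.sum_prod_type]
  exact Finset.sum_comm

lemma complementMarginal_ampACE {A B C E : Type*} [Fintype C] [Fintype E]
    (ψ : A × B × C × E → ℂ) :
    complementMarginal (ampACE ψ) = traceAux (complementMarginal (ampAC ψ)) := by
  ext p q
  simp only [complementMarginal, ampACE, ampAC, traceAux, Matrix.of_apply, Fintype.sum_prod_type]
  exact Finset.sum_comm

end QInfo

theorem theorem1 {A B C E : Type*} [Fintype A] [Fintype B] [Fintype C] [Fintype E]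
    [DecidableEq A] [DecidableEq B] [DecidableEq C] [DecidableEq E]
    (ρ : Matrix (A × B × C) (A × B × C) ℂ) (hρ : QInfo.IsState ρ)
    (ψ : A × B × C × E → ℂ) (hψ : QInfo.IsPurification ψ ρ) :
    QInfo.ssaGap ρ =
        (QInfo.eof (QInfo.margABE ψ) - QInfo.eof (QInfo.margAB ρ)) +
          (QInfo.discord (QInfo.margACE ψ) - QInfo.discord (QInfo.margAC ρ)) ∧
    QInfo.ssaGap ρ =
        (QInfo.eof (QInfo.margACE ψ) - QInfo.eof (QInfo.margAC ρ)) +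
          (QInfo.discord (QInfo.margABE ψ) - QInfo.discord (QInfo.margAB ρ)) ∧
    QInfo.ssaGap ρ =
        (QInfo.eof (QInfo.margABE ψ) + QInfo.eof (QInfo.margACE ψ)) -
          (QInfo.discord (QInfo.margAB ρ) + QInfo.discord (QInfo.margAC ρ)) ∧
    QInfo.ssaGap ρ =
        (QInfo.discord (QInfo.margABE ψ) + QInfo.discord (QInfo.margACE ψ)) -
          (QInfo.eof (QInfo.margAB ρ) + QInfo.eof (QInfo.margAC ρ)) ∧
    0 ≤ QInfo.eof (QInfo.margABE ψ) - QInfo.eof (QInfo.margAB ρ) ∧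
    0 ≤ QInfo.eof (QInfo.margACE ψ) - QInfo.eof (QInfo.margAC ρ) := by
  have htr := hρ.2
  have kwABE := QInfo.eof_sub_discord _ (hψ.trace_ampABE htr)
  have kwACE := QInfo.eof_sub_discord _ (hψ.trace_ampACE htr)
  have kwAB := QInfo.eof_sub_discord _ (hψ.trace_ampAB htr)
  have kwAC := QInfo.eof_sub_discord _ (hψ.trace_ampAC htr)
  have sCE := QInfo.entropy_traceFst_complementMarginal (QInfo.ampAB ψ)
  have sBE := QInfo.entropy_traceFst_complementMarginal (QInfo.ampAC ψ)
  have sC := QInfo.entropy_traceFst_complementMarginal (QInfo.ampABE ψ)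
  have sB := QInfo.entropy_traceFst_complementMarginal (QInfo.ampACE ψ)
  have monoB := QInfo.eof_le_of_traceAux _ (hψ.trace_ampAB htr) _ (hψ.trace_ampABE htr)
    (QInfo.complementMarginal_ampABE ψ)
  have monoC := QInfo.eof_le_of_traceAux _ (hψ.trace_ampAC htr) _ (hψ.trace_ampACE htr)
    (QInfo.complementMarginal_ampACE ψ)
  -- Each marginal occurs both as `Φ * Φᴴ` for one bipartition and as `complementMarginal` for
  -- another; naming both forms alike leaves a linear system.
  simp only [← QInfo.margABE_eq, ← QInfo.margACE_eq, ← hψ.margAB_eq, ← hψ.margAC_eq,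
    ← hψ.margAB_eq_complementMarginal, ← hψ.margAC_eq_complementMarginal,
    ← QInfo.margABE_eq_complementMarginal, ← QInfo.margACE_eq_complementMarginal]
    at kwABE kwACE kwAB kwAC sCE sBE sC sB monoB monoC
  rw [QInfo.ssaGap]
  refine ⟨?_, ?_, ?_, ?_, ?_, ?_⟩ <;> linarith
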